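/- Let $R$ be an associative ring with unit and let $n>1$ be an integer. A left $R$-module $M$ is finitely $n$-presented if there is an exact sequence $F_n\to F_{n-1}\to\cdots\to F_0\to M\to 0$ with all $F_i$ finitely generated free left $R$-modules; let $\mathrm{FP}_n$ be the class of these left modules. The ring $R$ is (left) $n$-hereditary if every finitely $(n-1)$-presented submodule of a finitely generated projective left $R$-module is projective. Let $\mathrm{FP}_n\text{-Inj}$ be the class of all left $R$-modules $M$ with $\mathrm{Ext}^1_R(F,M)=0$ for all $F\in \mathrm{FP}_n$, and let $\mathrm{FP}_n\text{-Flat}$ be the class of all right $R$-modules $M$ with $\mathrm{Tor}_1^R(M,F)=0$ for all $F\in\mathrm{FP}_n$. For a class $\mathcal C$ of objects of an abelian category $\mathcal A$, put $\mathcal C^{\perp}=\{X:\mathrm{Hom}_{\mathcal A}(C,X)=0 \text{ for all } C\in\mathcal C\}$ and ${}^{\perp}\mathcal C=\{X:\mathrm{Hom}_{\mathcal A}(X,C)=0\text{ for all } C\in\mathcal C\}$. A pair $(\mathcal T,\mathcal F)$ of classes of objects of $\mathcal A$ is a torsion pair if (i) $\mathrm{Hom}_{\mathcal A}(T,F)=0$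 for all $T\in\mathcal T$, $F\in\mathcal F$; (ii) every $C$ with $\mathrm{Hom}_{\mathcal A}(C,F)=0$ for all $F\in\mathcal F$ lies in $\mathcal T$; (iii) every $C$ with $\mathrm{Hom}_{\mathcal A}(T,C)=0$ for all $T\in\mathcal T$ lies in $\mathcal F$. Then the following are equivalent: (1) $R$ is $n$-hereditary; (2) $(\mathrm{FP}_n\text{-Inj},\ \mathrm{FP}_n\text{-Inj}^{\perp})$ is a torsion pair in the category of left $R$-modules; (3) $({}^{\perp}\mathrm{FP}_n\text{-Flat},\ \mathrm{FP}_n\text{-Flat})$ is a torsion pair in the category of right $R$-modules. (When $R$ is commutative, left and right modules coincide and both torsion pairs live in $R\text{-Mod}$.) -/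

import Mathlib

open CategoryTheory
open scoped TensorProduct

universe u

namespace TorsionPairs

section Presentations

variable (R : Type u) [Ring R]

/-- The class `FP_n` of finitely `n`-presented left `R`-modules: those `M` for which there is an
exact sequence `F_n → ⋯ → F_1 → F_0 → M → 0` with every `F_i` (`0 ≤ i ≤ n`) finitely generated
and free. (The sequence is indexed by all of `ℕ` for convenience; nothing is required of the
modules `F i` with `i > n`, nor of the maps `d i` with `i ≥ n`.) -/
def FP (n : ℕ) : ObjectProperty (ModuleCat.{u} R) := fun M =>
  ∃ (F : ℕ → ModuleCat.{u} R) (d : ∀ i, F (i + 1) →ₗ[R] F i) (ε : F 0 →ₗ[R] M),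
    (∀ i ≤ n, Module.Finite R (F i) ∧ Module.Free R (F i)) ∧
    Function.Surjective ε ∧
    (0 < n → Function.Exact (d 0) ε) ∧
    ∀ i, i + 1 < n → Function.Exact (d (i + 1)) (d i)

/-- `R` is left `n`-hereditary: every finitely `(n-1)`-presented submodule of a finitely generated
projective left module is projective. (Every module counts as finitely `(-1)`-presented.) -/
def IsLeftHereditary (n : ℕ) : Prop :=
  ∀ (P : Type u) [AddCommGroup P] [Module R P] [Module.Finite R P] [Module.Projective R P]
    (N : Submodule R P), (1 ≤ n → FP R (n - 1) (ModuleCat.of R N)) → Module.Projective R N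

/-- The class of `FP_n`-injective left modules: `Ext¹_R(F, M) = 0` for all `F` in `FP_n`. -/
def FPInj (n : ℕ) : ObjectProperty (ModuleCat.{u} R) := fun M =>
  ∀ F : ModuleCat.{u} R, FP R n F → Subsingleton (Abelian.Ext F M 1)

end Presentations

section Tensor

/-! Right `R`-modules are modules over the opposite ring `Rᵐᵒᵖ`, so that `m r` is
`MulOpposite.op r • m`. Mathlib has tensor products only over commutative rings, so the tensor
product of a right and a left module over `R` is built here. -/

variable {R : Type u} [Ring R]

/-- The subgroup of `M ⊗_ℤ N` generated by the elements `m r ⊗ n - m ⊗ r n`. -/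
def tensorRelations (M : ModuleCat.{u} Rᵐᵒᵖ) (N : ModuleCat.{u} R) :
    Submodule ℤ (M ⊗[ℤ] N) :=
  Submodule.span ℤ {t | ∃ (m : M) (r : R) (n : N),
    t = (MulOpposite.op r • m) ⊗ₜ[ℤ] n - m ⊗ₜ[ℤ] (r • n)}

/-- The map `M ⊗_ℤ N → M ⊗_ℤ N'` induced by an `R`-linear map `N → N'`. -/
noncomputable def tensorMap (M : ModuleCat.{u} Rᵐᵒᵖ) {N N' : ModuleCat.{u} R} (f : N ⟶ N') :
    M ⊗[ℤ] N →ₗ[ℤ] M ⊗[ℤ] N' :=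
  LinearMap.lTensor M f.hom.toAddMonoidHom.toIntLinearMap

theorem tensorMap_tmul (M : ModuleCat.{u} Rᵐᵒᵖ) {N N' : ModuleCat.{u} R} (f : N ⟶ N')
    (m : M) (n : N) : tensorMap M f (m ⊗ₜ[ℤ] n) = m ⊗ₜ[ℤ] (f.hom n) := rfl

theorem tensorRelations_le_comap (M : ModuleCat.{u} Rᵐᵒᵖ) {N N' : ModuleCat.{u} R} (f : N ⟶ N') :
    tensorRelations M N ≤ (tensorRelations M N').comap (tensorMap M f) := by
  refine Submodule.span_le.2 ?_
  rintro _ ⟨m, r, n, rfl⟩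
  refine Submodule.subset_span ⟨m, r, f.hom n, ?_⟩
  rw [map_sub, tensorMap_tmul, tensorMap_tmul, map_smul]

/-- The functor `M ⊗_R -` from left `R`-modules to abelian groups, for a right `R`-module `M`. -/
noncomputable def tensorFunctor (M : ModuleCat.{u} Rᵐᵒᵖ) : ModuleCat.{u} R ⥤ ModuleCat.{u} ℤ where
  obj N := ModuleCat.of ℤ ((M ⊗[ℤ] N) ⧸ tensorRelations M N)
  map {N N'} f := ModuleCat.ofHom
    (Submodule.mapQ (tensorRelations M N) (tensorRelations M N') (tensorMap M f)
      (tensorRelations_le_comap M f))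
  map_id N := by
    ext : 1
    refine Submodule.linearMap_qext _ (TensorProduct.ext' fun m n => ?_)
    rfl
  map_comp f g := by
    ext : 1
    refine Submodule.linearMap_qext _ (TensorProduct.ext' fun m n => ?_)
    rfl

instance tensorFunctor_additive (M : ModuleCat.{u} Rᵐᵒᵖ) : (tensorFunctor M).Additive where
  map_add {N N' f g} := by
    ext : 1
    refine Submodule.linearMap_qext _ (TensorProduct.ext' fun m n => ?_)
    exact congrArg (Submodule.mkQ (tensorRelations M N')) (TensorProduct.tmul_add m (f.hom n) (g.hom n))

/-- `Tor_i^R(M, N)` for a right module `M` and a left module `N`: the value at `N` of the `i`-th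
left derived functor of `M ⊗_R -`. -/
noncomputable def Tor (i : ℕ) (M : ModuleCat.{u} Rᵐᵒᵖ) (N : ModuleCat.{u} R) : ModuleCat.{u} ℤ :=
  ((tensorFunctor M).leftDerived i).obj N

end Tensor

/-- The class of `FP_n`-flat modules: the right modules `M` with `Tor_1^R(M, F) = 0` for all left
modules `F` in `FP_n`. -/
def FPFlat (R : Type u) [Ring R] (n : ℕ) : ObjectProperty (ModuleCat.{u} Rᵐᵒᵖ) := fun M =>
  ∀ F : ModuleCat.{u} R, FP R n F → Subsingleton (Tor 1 M F)

/-- `(T, F)` is a torsion pair in the abelian category `A`. -/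
structure IsTorsionPair {A : Type*} [Category A] [Abelian A] (T F : ObjectProperty A) : Prop where
  hom_eq_zero : ∀ ⦃X Y : A⦄, T X → F Y → ∀ f : X ⟶ Y, f = 0
  torsion_of_hom_eq_zero : ∀ C : A, (∀ Y : A, F Y → ∀ f : C ⟶ Y, f = 0) → T C
  torsionFree_of_hom_eq_zero : ∀ C : A, (∀ X : A, T X → ∀ f : X ⟶ C, f = 0) → F C

end TorsionPairs

/-! Let `F` be in `FP_n`. As `n > 1`, there are finite free `F₂ → F₁ → F₀ → F → 0` whose first
syzygy `K = ker (F₀ → F)` is finitely `(n-1)`-presented. If `R` is `n`-hereditary, `K` is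
projective. Injective side: `Ext¹(F, M) = 0` says that maps `K → M` extend to `F₀`. With `K`
projective and finite, this property passes to quotients, extensions and directed unions, so each
`C` has a largest `FP_n`-injective submodule, and the quotient by it receives no nonzero map from
the class. Conversely, a torsion class is closed under quotients, so quotients of injectives are
`FP_n`-injective, which forces `K` to be projective. Flat side: if `A`, `B` are the matrices of `F₂
→ F₁ → F₀`, then `Tor₁(M, F) = 0` says that every row `v` over `M` with `vB = 0` has the form `wA`.
For `K` projective, `A = ACA` for some `C`; with the idempotent `E = CA` the condition reads `vB = 0
→ vE = v`, an implication between linear equations. So each `C` has a least submodule with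
`FP_n`-flat quotient, and this submodule has no nonzero map to a flat module. Conversely, a
torsion-free class is closed under submodules; flatness of the column space of `A` produces `C` with
`ACA = A`, which splits the syzygy. -/

namespace TorsionPairs

/-! ### Comparison of projective resolutions -/

section Comparison

variable {C : Type*} [Category C] [Abelian C]

theorem exists_lift_of_exact {P X Y Z : C} [Projective P] {f : X ⟶ Y} {g : Y ⟶ Z} {w : f ≫ g = 0}
    (h : (ShortComplex.mk f g w).Exact) (φ : P ⟶ Y) (hφ : φ ≫ g = 0) : ∃ ψ : P ⟶ X, ψ ≫ f = φ :=
  ⟨h.liftFromProjective φ hφ, h.liftFromProjective_comp φ hφ⟩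

/-- Whether an additive functor preserves exactness of the first terms of a projective resolution
does not depend on the resolution. -/
theorem exact_map_of_exact_map (T : C ⥤ ModuleCat.{u} ℤ) [T.Additive] {F F₀ F₁ F₂ P₀ P₁ P₂ : C}
    [Projective F₀] [Projective F₁] [Projective P₀] [Projective P₁] [Projective P₂]
    {f : F₂ ⟶ F₁} {g : F₁ ⟶ F₀} {ε : F₀ ⟶ F} [Epi ε] {w : f ≫ g = 0} {w' : g ≫ ε = 0}
    (h : (ShortComplex.mk f g w).Exact) (h' : (ShortComplex.mk g ε w').Exact)
    {p : P₂ ⟶ P₁} {q : P₁ ⟶ P₀} {π : P₀ ⟶ F} [Epi π] (v : p ≫ q = 0) {v' : q ≫ π = 0}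
    (k' : (ShortComplex.mk q π v').Exact)
    (hT : Function.Exact (T.map p).hom (T.map q).hom) :
    Function.Exact (T.map f).hom (T.map g).hom := by
  let a₀ := Projective.factorThru ε π
  have ha₀ : a₀ ≫ π = ε := Projective.factorThru_comp _ _
  let b₀ := Projective.factorThru π ε
  have hb₀ : b₀ ≫ ε = π := Projective.factorThru_comp _ _
  obtain ⟨a₁, ha₁⟩ := exists_lift_of_exact k' (g ≫ a₀) (by rw [Category.assoc, ha₀, w'])
  obtain ⟨b₁, hb₁⟩ := exists_lift_of_exact h' (q ≫ b₀) (by rw [Category.assoc, hb₀, v'])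
  obtain ⟨b₂, hb₂⟩ := exists_lift_of_exact h (p ≫ b₁) (by
    rw [Category.assoc, hb₁, reassoc_of% v, Limits.zero_comp])
  obtain ⟨h₀, hh₀⟩ := exists_lift_of_exact h' (𝟙 F₀ - a₀ ≫ b₀) (by
    rw [Preadditive.sub_comp, Category.assoc, hb₀, ha₀, Category.id_comp, sub_self])
  obtain ⟨h₁, hh₁⟩ := exists_lift_of_exact h (𝟙 F₁ - a₁ ≫ b₁ - g ≫ h₀) (by
    rw [Preadditive.sub_comp, Preadditive.sub_comp, Category.assoc, Category.assoc, hb₁, hh₀,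
      reassoc_of% ha₁, Preadditive.comp_sub, Category.id_comp, Category.comp_id, sub_self])
  -- Degree-one part of a homotopy from the round trip through the other resolution to the identity.
  -- On `ker (T g)` the middle term dies, and the last one lands in the image of `T f` via `b₂`.
  have key : 𝟙 F₁ = h₁ ≫ f + g ≫ h₀ + a₁ ≫ b₁ := by rw [hh₁]; abel
  intro z
  constructor
  · intro hz
    have ez : z = (T.map f).hom ((T.map h₁).hom z) + (T.map h₀).hom ((T.map g).hom z) +
        (T.map b₁).hom ((T.map a₁).hom z) := by
      have e := congrArg (fun φ => (T.map φ).hom z) key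
      simp only [T.map_id, T.map_add, T.map_comp] at e
      exact e
    obtain ⟨y, hy⟩ := (hT ((T.map a₁).hom z)).1 (by
      have e := congrArg (fun φ => (T.map φ).hom z) ha₁
      simp only [T.map_comp] at e
      refine e.trans ?_
      change (T.map a₀).hom ((T.map g).hom z) = 0
      rw [hz, map_zero])
    have e := congrArg (fun φ => (T.map φ).hom y) hb₂
    simp only [T.map_comp] at e
    refine ⟨(T.map h₁).hom z + (T.map b₂).hom y, ?_⟩
    rw [map_add]
    conv_rhs => rw [ez, hz, map_zero, add_zero, ← hy]
    exact congrArg _ e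
  · rintro ⟨y, rfl⟩
    have e := congrArg (fun φ => (T.map φ).hom y) w
    simp only [T.map_comp, T.map_zero] at e
    exact e

end Comparison

/-! ### `Tor₁` from a partial resolution -/

section Tor

variable {R : Type u} [Ring R]

theorem subsingleton_Tor_one_iff_of_projectiveResolution (M : ModuleCat.{u} Rᵐᵒᵖ)
    {F : ModuleCat.{u} R} (P : ProjectiveResolution F) :
    Subsingleton (Tor 1 M F) ↔
      Function.Exact ((tensorFunctor M).map (P.complex.d 2 1)).hom
        ((tensorFunctor M).map (P.complex.d 1 0)).hom := by
  have i := P.isoLeftDerivedObj (tensorFunctor M) 1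
  rw [show Tor 1 M F = ((tensorFunctor M).leftDerived 1).obj F from rfl,
    ← ModuleCat.isZero_iff_subsingleton, i.isZero_iff]
  change Limits.IsZero ((((tensorFunctor M).mapHomologicalComplex _).obj P.complex).homology 1) ↔ _
  rw [← HomologicalComplex.exactAt_iff_isZero_homology,
    HomologicalComplex.exactAt_iff' _ 2 1 0 (by simp) (by simp)]
  exact ShortComplex.ShortExact.moduleCat_exact_iff_function_exact _

/-- `Tor₁` may be computed from the first three terms of a projective resolution. -/
theorem subsingleton_Tor_one_iff (M : ModuleCat.{u} Rᵐᵒᵖ) {F₂ F₁ F₀ F : ModuleCat.{u} R}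
    [Module.Projective R F₀] [Module.Projective R F₁] [Module.Projective R F₂]
    (f : F₂ ⟶ F₁) (g : F₁ ⟶ F₀) (ε : F₀ ⟶ F) (h : Function.Exact f.hom g.hom)
    (h' : Function.Exact g.hom ε.hom) (hε : Function.Surjective ε.hom) :
    Subsingleton (Tor 1 M F) ↔
      Function.Exact ((tensorFunctor M).map f).hom ((tensorFunctor M).map g).hom := by
  have p₀ : Projective F₀ := (IsProjective.iff_projective F₀).1 inferInstance
  have p₁ : Projective F₁ := (IsProjective.iff_projective F₁).1 inferInstance
  have p₂ : Projective F₂ := (IsProjective.iff_projective F₂).1 inferInstance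
  have : Epi ε := (ModuleCat.epi_iff_surjective _).2 hε
  have w : f ≫ g = 0 := by ext x; exact h.apply_apply_eq_zero x
  have w' : g ≫ ε = 0 := by ext x; exact h'.apply_apply_eq_zero x
  have e : (ShortComplex.mk f g w).Exact :=
    (ShortComplex.ShortExact.moduleCat_exact_iff_function_exact _).2 h
  have e' : (ShortComplex.mk g ε w').Exact :=
    (ShortComplex.ShortExact.moduleCat_exact_iff_function_exact _).2 h'
  let P := projectiveResolution F
  let π : P.complex.X 0 ⟶ F := P.π.f 0
  have hπ : Epi π := inferInstanceAs (Epi (P.π.f 0))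
  have k : (ShortComplex.mk (P.complex.d 2 1) (P.complex.d 1 0) (by simp)).Exact := P.exact_succ 0
  have k' : (ShortComplex.mk (P.complex.d 1 0) π P.complex_d_comp_π_f_zero).Exact := P.exact₀
  rw [subsingleton_Tor_one_iff_of_projectiveResolution M P]
  exact ⟨exact_map_of_exact_map _ e e' (by simp) k', exact_map_of_exact_map _ k k' w e'⟩

end Tor

/-! ### Row vectors over a right module -/

section RowVectors

variable {R : Type u} [Ring R] {M M' : Type*} [AddCommGroup M] [Module Rᵐᵒᵖ M]
  [AddCommGroup M'] [Module Rᵐᵒᵖ M'] {ι κ ν : Type*} [Fintype ι]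

/-- The product `v A` of a row vector with entries in a right module and a matrix. -/
def rowMul (v : ι → M) (A : Matrix ι κ R) : κ → M :=
  fun j => ∑ i, MulOpposite.op (A i j) • v i

theorem rowMul_zero_left (A : Matrix ι κ R) : rowMul (0 : ι → M) A = 0 := by
  ext j; simp [rowMul]

theorem rowMul_zero_right (v : ι → M) : rowMul v (0 : Matrix ι κ R) = 0 := by
  ext j; simp [rowMul]

theorem rowMul_sub (v w : ι → M) (A : Matrix ι κ R) :
    rowMul (v - w) A = rowMul v A - rowMul w A := by
  ext j; simp [rowMul, smul_sub]

theorem rowMul_mul [Fintype κ] (v : ι → M) (A : Matrix ι κ R) (B : Matrix κ ν R) :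
    rowMul v (A * B) = rowMul (rowMul v A) B := by
  ext j
  simp only [rowMul, Matrix.mul_apply, Finset.smul_sum, smul_smul, ← MulOpposite.op_mul]
  rw [Finset.sum_comm]
  exact Finset.sum_congr rfl fun i _ => by
    rw [← Finset.sum_smul, Finset.op_sum]

theorem map_rowMul (φ : M →ₗ[Rᵐᵒᵖ] M') (v : ι → M) (A : Matrix ι κ R) :
    (fun j => φ (rowMul v A j)) = rowMul (fun i => φ (v i)) A := by
  ext j; simp [rowMul]

end RowVectors

/-! ### Tensoring with finite free modules in coordinates -/

section TensorFree

variable {R : Type u} [Ring R] (M : ModuleCat.{u} Rᵐᵒᵖ) {F F' F'' : ModuleCat.{u} R}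
  {ι κ ν : Type u}

/-- The coordinates of an element of `M ⊗_R F` with respect to a basis of `F`. -/
noncomputable def tensorCoords (b : Module.Basis ι R F) :
    (tensorFunctor M).obj F →ₗ[ℤ] (ι → M) :=
  (tensorRelations M F).liftQ
    (TensorProduct.lift (AddMonoidHom.mk'
      (fun m => (AddMonoidHom.mk' (fun x i => MulOpposite.op (b.coord i x) • m) fun x y => by
        ext i
        simp only [map_add, MulOpposite.op_add, add_smul, Pi.add_apply]).toIntLinearMap)
      fun m m' => LinearMap.ext fun x => funext fun i => smul_add _ _ _).toIntLinearMap) <| by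
    refine Submodule.span_le.2 ?_
    rintro _ ⟨m, r, x, rfl⟩
    refine LinearMap.mem_ker.2 ((LinearMap.map_sub _ _ _).trans (sub_eq_zero.2 ?_))
    ext i
    change MulOpposite.op (b.coord i x) • MulOpposite.op r • m =
      MulOpposite.op (b.coord i (r • x)) • m
    rw [map_smul, smul_eq_mul, MulOpposite.op_mul, mul_smul]

theorem tensorCoords_mk (b : Module.Basis ι R F) (m : M) (x : F) (i : ι) :
    tensorCoords M b (Submodule.Quotient.mk (m ⊗ₜ[ℤ] x)) i = MulOpposite.op (b.repr x i) • m :=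
  rfl

/-- The element of `M ⊗_R F` with given coordinates with respect to a basis of `F`. -/
noncomputable def ofTensorCoords [Fintype ι] (b : Module.Basis ι R F) (v : ι → M) :
    (tensorFunctor M).obj F :=
  ∑ i, (tensorRelations M F).mkQ (v i ⊗ₜ[ℤ] b i)

theorem mk_op_smul_tmul (m : M) (r : R) (x : F) :
    (tensorRelations M F).mkQ ((MulOpposite.op r • m) ⊗ₜ[ℤ] x) =
      (tensorRelations M F).mkQ (m ⊗ₜ[ℤ] (r • x)) := by
  rw [← sub_eq_zero, ← map_sub]
  exact (Submodule.Quotient.mk_eq_zero _).2 (Submodule.subset_span ⟨m, r, x, rfl⟩)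

theorem tensorCoords_ofTensorCoords [Fintype ι] [DecidableEq ι] (b : Module.Basis ι R F)
    (v : ι → M) :
    tensorCoords M b (ofTensorCoords M b v) = v := by
  ext i
  unfold ofTensorCoords
  erw [map_sum]
  rw [Finset.sum_apply, Finset.sum_eq_single i]
  · exact (tensorCoords_mk M b _ _ _).trans (by simp)
  · intro j _ hj
    exact (tensorCoords_mk M b _ _ _).trans (by simp [hj])
  · simp

theorem ofTensorCoords_tensorCoords [Fintype ι] (b : Module.Basis ι R F)
    (t : (tensorFunctor M).obj F) :
    ofTensorCoords M b (tensorCoords M b t) = t := by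
  have hadd : ∀ v w : ι → M, ofTensorCoords M b (v + w) =
      ofTensorCoords M b v + ofTensorCoords M b w := fun v w => by
    simp only [ofTensorCoords, Pi.add_apply, TensorProduct.add_tmul, map_add]
    exact Finset.sum_add_distrib
  obtain ⟨t, rfl⟩ := Submodule.mkQ_surjective (tensorRelations M F) t
  induction t using TensorProduct.induction_on with
  | zero =>
    erw [map_zero, map_zero]
    simp only [ofTensorCoords, Pi.zero_apply, TensorProduct.zero_tmul, map_zero]
    exact Finset.sum_const_zero
  | tmul m x =>
    conv_rhs => rw [← b.sum_repr x, TensorProduct.tmul_sum, map_sum]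
    exact Finset.sum_congr rfl fun i _ => mk_op_smul_tmul M m (b.repr x i) (b i)
  | add s t hs ht =>
    rw [map_add]
    erw [map_add]
    rw [hadd]
    exact congrArg₂ (· + ·) hs ht

theorem tensorCoords_bijective [Fintype ι] (b : Module.Basis ι R F) :
    Function.Bijective (tensorCoords M b) := by
  classical
  exact Function.bijective_iff_has_inverse.2 ⟨ofTensorCoords M b,
    ofTensorCoords_tensorCoords M b, tensorCoords_ofTensorCoords M b⟩

/-- The matrix of a linear map with respect to bases, acting on row vectors. -/
noncomputable def rowMatrix (b : Module.Basis ι R F) (b' : Module.Basis κ R F') (f : F ⟶ F') :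
    Matrix ι κ R :=
  fun i j => b'.repr (f.hom (b i)) j

theorem repr_hom_apply [Fintype ι] (b : Module.Basis ι R F) (b' : Module.Basis κ R F')
    (f : F ⟶ F') (x : F)
    (j : κ) : b'.repr (f.hom x) j = ∑ i, b.repr x i * rowMatrix b b' f i j := by
  conv_lhs => rw [← b.sum_repr x]
  simp only [rowMatrix, map_sum, map_smul, Finsupp.finsetSum_apply, Finsupp.smul_apply,
    smul_eq_mul]

theorem rowMatrix_zero (b : Module.Basis ι R F) (b' : Module.Basis κ R F') :
    rowMatrix b b' (0 : F ⟶ F') = 0 := by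
  ext i j; simp [rowMatrix]

/-- Images of basis vectors are rows, so composition in diagrammatic order matches the matrix
product without passing to the opposite ring. -/
theorem rowMatrix_comp [Fintype κ] (b : Module.Basis ι R F) (b' : Module.Basis κ R F')
    (b'' : Module.Basis ν R F'') (f : F ⟶ F') (g : F' ⟶ F'') :
    rowMatrix b b'' (f ≫ g) = rowMatrix b b' f * rowMatrix b' b'' g := by
  ext i j
  exact repr_hom_apply b' b'' g _ j

theorem tensorCoords_map [Fintype ι] (b : Module.Basis ι R F) (b' : Module.Basis κ R F')
    (f : F ⟶ F')
    (t : (tensorFunctor M).obj F) :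
    tensorCoords M b' (((tensorFunctor M).map f).hom t) =
      rowMul (tensorCoords M b t) (rowMatrix b b' f) := by
  obtain ⟨t, rfl⟩ := Submodule.mkQ_surjective (tensorRelations M F) t
  ext j
  induction t using TensorProduct.induction_on with
  | zero =>
    rw [map_zero]
    erw [map_zero, map_zero, rowMul_zero_left]
  | tmul m x =>
    refine (tensorCoords_mk M b' m (f.hom x) j).trans ?_
    rw [repr_hom_apply b b' f, Finset.op_sum, Finset.sum_smul]
    refine Finset.sum_congr rfl fun i _ => ?_
    rw [MulOpposite.op_mul, mul_smul]
    rfl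
  | add s t hs ht =>
    rw [map_add]
    erw [map_add, map_add, map_add]
    simp only [rowMul, Pi.add_apply, smul_add, Finset.sum_add_distrib] at hs ht ⊢
    exact congrArg₂ (· + ·) hs ht

/-- `M ⊗_R -` preserves exactness of a sequence of finite free modules iff the corresponding
homogeneous linear system over `M` has only the obvious solutions. -/
theorem exact_tensorFunctor_map_iff [Fintype ι] [Fintype κ] [Fintype ν]
    (b : Module.Basis ι R F) (b' : Module.Basis κ R F') (b'' : Module.Basis ν R F'')
    (f : F ⟶ F') (g : F' ⟶ F'') :
    Function.Exact ((tensorFunctor M).map f).hom ((tensorFunctor M).map g).hom ↔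
      ∀ v : κ → M, rowMul v (rowMatrix b' b'' g) = 0 ↔
        ∃ w : ι → M, rowMul w (rowMatrix b b' f) = v := by
  rw [Function.Exact, (tensorCoords_bijective M b').surjective.forall]
  refine forall_congr' fun t => iff_congr ?_ ?_
  · rw [← tensorCoords_map, map_eq_zero_iff _ (tensorCoords_bijective M b'').injective]
  · rw [(tensorCoords_bijective M b).surjective.exists, Set.mem_range]
    refine exists_congr fun s => ?_
    rw [← tensorCoords_map, (tensorCoords_bijective M b').injective.eq_iff]

end TensorFree

/-! ### Finite presentations and splitting of syzygies -/

section Presentation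

variable {R : Type u} [Ring R] {n : ℕ}

/-- A finitely `n`-presented module, `n > 1`, has a finite free presentation of length two such
that the kernel of the augmentation is finitely `(n-1)`-presented. -/
theorem FP.exists_presentation (hn : 1 < n) {F : ModuleCat.{u} R} (h : FP R n F) :
    ∃ (F₂ F₁ F₀ : ModuleCat.{u} R) (f : F₂ ⟶ F₁) (g : F₁ ⟶ F₀) (ε : F₀ ⟶ F),
      (Module.Finite R F₂ ∧ Module.Free R F₂) ∧ (Module.Finite R F₁ ∧ Module.Free R F₁) ∧
      (Module.Finite R F₀ ∧ Module.Free R F₀) ∧ Function.Exact f.hom g.hom ∧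
      Function.Exact g.hom ε.hom ∧ Function.Surjective ε.hom ∧
      FP R (n - 1) (ModuleCat.of R (LinearMap.ker ε.hom)) := by
  obtain ⟨F, d, ε, hF, hε, h₀, hd⟩ := h
  have h₀ := h₀ (by omega)
  refine ⟨F 2, F 1, F 0, ModuleCat.ofHom (d 1), ModuleCat.ofHom (d 0), ModuleCat.ofHom ε,
    hF 2 (by omega), hF 1 (by omega), hF 0 (by omega), hd 0 (by omega), h₀, hε,
    fun i => F (i + 1), fun i => d (i + 1),
    (d 0).codRestrict (LinearMap.ker ε) fun x => h₀.apply_apply_eq_zero x,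
    fun i hi => hF (i + 1) (by omega), ?_, fun _ x => ?_, fun i hi => hd (i + 1) (by omega)⟩
  · rintro ⟨y, hy⟩
    obtain ⟨x, rfl⟩ := (h₀ y).1 hy
    exact ⟨x, rfl⟩
  · rw [← hd 0 (by omega) x, ← Subtype.coe_inj]
    rfl

/-- A module with a finite free cover whose kernel is finitely `n`-presented is finitely
`(n+1)`-presented. -/
theorem FP.succ_of_exact {N F₀ F : ModuleCat.{u} R} [Module.Finite R F₀] [Module.Free R F₀]
    (i : N →ₗ[R] F₀) (ε : F₀ →ₗ[R] F) (hi : Function.Injective i) (h : Function.Exact i ε)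
    (hε : Function.Surjective ε) (hN : FP R n N) : FP R (n + 1) F := by
  obtain ⟨G, d, p, hG, hp, h₀, hd⟩ := hN
  refine ⟨fun | 0 => F₀ | k + 1 => G k, fun | 0 => i.comp p | k + 1 => d k, ε, ?_, hε, ?_, ?_⟩
  · rintro (_ | k) hk
    · exact ⟨‹_›, ‹_›⟩
    · exact hG k (by omega)
  · intro _ y
    rw [h y]
    exact ⟨fun ⟨x, hx⟩ => (hp x).imp fun z hz => by simp [hz, hx], fun ⟨z, hz⟩ => ⟨p z, hz⟩⟩
  · rintro (_ | k) hk
    · intro y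
      rw [← h₀ (by omega) y]
      exact map_eq_zero_iff i hi
    · exact hd k (by omega)

/-- Over an `n`-hereditary ring the second syzygies of finitely `n`-presented modules split off. -/
theorem IsLeftHereditary.exists_comp_eq (hR : IsLeftHereditary R n) {F₂ F₁ F₀ F : ModuleCat.{u} R}
    [Module.Finite R F₀] [Module.Projective R F₀] [Module.Projective R F₁]
    {f : F₂ ⟶ F₁} {g : F₁ ⟶ F₀} {ε : F₀ ⟶ F} (h : Function.Exact f.hom g.hom)
    (h' : Function.Exact g.hom ε.hom)
    (hK : FP R (n - 1) (ModuleCat.of R (LinearMap.ker ε.hom))) :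
    ∃ c : F₁ ⟶ F₂, f ≫ c ≫ f = f := by
  have : Module.Projective R (LinearMap.ker ε.hom) := hR F₀ _ fun _ => hK
  let q : F₁ →ₗ[R] LinearMap.ker ε.hom :=
    g.hom.codRestrict _ fun x => h'.apply_apply_eq_zero x
  have hq : Function.Surjective q := by
    rintro ⟨y, hy⟩
    obtain ⟨x, rfl⟩ := (h' y).1 hy
    exact ⟨x, rfl⟩
  obtain ⟨s, hs⟩ := Module.projective_lifting_property q LinearMap.id hq
  have hqf : ∀ x, q (f.hom x) = 0 := fun x => Subtype.ext (h.apply_apply_eq_zero x)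
  have hr : ∀ x, (LinearMap.id - s.comp q : F₁ →ₗ[R] F₁) x ∈ LinearMap.range f.hom := fun x => by
    refine (h _).1 ?_
    have e : q (x - s (q x)) = 0 := by
      rw [map_sub, show q (s (q x)) = q x from LinearMap.congr_fun hs (q x), sub_self]
    exact congrArg Subtype.val e
  -- `id - s q` projects `F₁` onto `ker q = im f`; `c` lifts this projection to `F₂`, and `q f = 0`
  -- gives `f c f = f`.
  obtain ⟨c, hc⟩ := Module.projective_lifting_property f.hom.rangeRestrict
    ((LinearMap.id - s.comp q : F₁ →ₗ[R] F₁).codRestrict _ hr) f.hom.surjective_rangeRestrict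
  refine ⟨ModuleCat.ofHom c, ?_⟩
  ext x
  have e := congrArg Subtype.val (LinearMap.congr_fun hc (f.hom x))
  change f.hom (c (f.hom x)) = f.hom x - s (q (f.hom x)) at e
  rw [hqf, map_zero, sub_zero] at e
  exact e

/-- `id - f c` kills `im f = ker p`, so it descends to a section of `p`. -/
theorem projective_of_comp_eq {F₂ F₁ N : Type*} [AddCommGroup F₂] [AddCommGroup F₁]
    [AddCommGroup N] [Module R F₂] [Module R F₁] [Module R N] [Module.Projective R F₁]
    {f : F₂ →ₗ[R] F₁} {p : F₁ →ₗ[R] N} (h : Function.Exact f p) (hp : Function.Surjective p)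
    (c : F₁ →ₗ[R] F₂) (hc : ∀ x, f (c (f x)) = f x) : Module.Projective R N := by
  have hk : LinearMap.ker p ≤ LinearMap.ker (LinearMap.id - f.comp c) := fun x hx => by
    obtain ⟨y, rfl⟩ := (h x).1 hx
    simp [hc]
  refine Module.Projective.of_split
    ((LinearMap.ker p).liftQ _ hk ∘ₗ (p.quotKerEquivOfSurjective hp).symm.toLinearMap) p ?_
  refine LinearMap.ext fun y => ?_
  obtain ⟨x, rfl⟩ := hp y
  have e : (p.quotKerEquivOfSurjective hp).symm (p x) = Submodule.Quotient.mk x := by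
    rw [LinearEquiv.symm_apply_eq]; rfl
  simp [e, h.apply_apply_eq_zero]

end Presentation

/-! ### From `n`-hereditary to the flat torsion pair -/

section Flat

variable {R : Type u} [Ring R] {n : ℕ}

theorem subsingleton_Tor_one_iff_rowMul (M : ModuleCat.{u} Rᵐᵒᵖ) {F₂ F₁ F₀ F : ModuleCat.{u} R}
    {ι κ ν : Type u} [Fintype ι] [Fintype κ] [Fintype ν] (b : Module.Basis ι R F₂)
    (b' : Module.Basis κ R F₁) (b'' : Module.Basis ν R F₀)
    {f : F₂ ⟶ F₁} {g : F₁ ⟶ F₀} {ε : F₀ ⟶ F} (h : Function.Exact f.hom g.hom)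
    (h' : Function.Exact g.hom ε.hom) (hε : Function.Surjective ε.hom) :
    Subsingleton (Tor 1 M F) ↔ ∀ v : κ → M, rowMul v (rowMatrix b' b'' g) = 0 →
      ∃ w : ι → M, rowMul w (rowMatrix b b' f) = v := by
  have := Module.Projective.of_basis b
  have := Module.Projective.of_basis b'
  have := Module.Projective.of_basis b''
  rw [subsingleton_Tor_one_iff M f g ε h h' hε, exact_tensorFunctor_map_iff M b b' b'' f g]
  refine forall_congr' fun v => ⟨fun e => e.1, fun e => ⟨e, ?_⟩⟩
  rintro ⟨w, rfl⟩
  have w₀ : f ≫ g = 0 := by ext x; exact h.apply_apply_eq_zero x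
  rw [← rowMul_mul, ← rowMatrix_comp, w₀, rowMatrix_zero, rowMul_zero_right]

/-- Over an `n`-hereditary ring, `Tor₁(-, F) = 0` is given by a system of implications between
linear equations. -/
theorem IsLeftHereditary.exists_matrix (hn : 1 < n) (hR : IsLeftHereditary R n)
    {F : ModuleCat.{u} R} (hF : FP R n F) :
    ∃ (κ ν : Type u) (_ : Fintype κ) (_ : Fintype ν) (B : Matrix κ ν R) (E : Matrix κ κ R),
      E * E = E ∧ E * B = 0 ∧ ∀ M : ModuleCat.{u} Rᵐᵒᵖ, Subsingleton (Tor 1 M F) ↔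
        ∀ v : κ → M, rowMul v B = 0 → rowMul v E = v := by
  obtain ⟨F₂, F₁, F₀, f, g, ε, ⟨_, _⟩, ⟨_, _⟩, ⟨_, _⟩, h, h', hε, hK⟩ := hF.exists_presentation hn
  have := Module.Projective.of_free (R := R) (P := F₀)
  have := Module.Projective.of_free (R := R) (P := F₁)
  obtain ⟨c, hc⟩ := hR.exists_comp_eq h h' hK
  let b₂ := Module.Free.chooseBasis R F₂
  let b₁ := Module.Free.chooseBasis R F₁
  let b₀ := Module.Free.chooseBasis R F₀
  have hfg : f ≫ g = 0 := by ext x; exact h.apply_apply_eq_zero x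
  refine ⟨_, _, inferInstance, inferInstance, rowMatrix b₁ b₀ g, rowMatrix b₁ b₁ (c ≫ f),
    ?_, ?_, fun M => ?_⟩
  · rw [← rowMatrix_comp, Category.assoc, hc]
  · rw [← rowMatrix_comp, Category.assoc, hfg, Limits.comp_zero, rowMatrix_zero]
  · rw [subsingleton_Tor_one_iff_rowMul M b₂ b₁ b₀ h h' hε]
    -- With `E = CA`: if `v = wA` then `vE = wACA = v`; conversely `v = vE = (vC)A`.
    refine forall_congr' fun v => imp_congr_right fun _ => ⟨?_, fun e => ?_⟩
    · rintro ⟨w, rfl⟩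
      rw [← rowMul_mul, ← rowMatrix_comp, hc]
    · exact ⟨rowMul v (rowMatrix b₁ b₂ c), by rw [← rowMul_mul, ← rowMatrix_comp, e]⟩

/-- The equation `vE = v` modulo an intersection can be checked modulo each member. -/
theorem IsLeftHereditary.fpFlat_quotient_sInf (hn : 1 < n) (hR : IsLeftHereditary R n)
    (C : ModuleCat.{u} Rᵐᵒᵖ) (S : Set (Submodule Rᵐᵒᵖ C))
    (hS : ∀ N ∈ S, FPFlat R n (ModuleCat.of Rᵐᵒᵖ (C ⧸ N))) :
    FPFlat R n (ModuleCat.of Rᵐᵒᵖ (C ⧸ sInf S)) := by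
  intro F hF
  obtain ⟨κ, ν, _, _, B, E, -, -, h⟩ := hR.exists_matrix hn hF
  refine (h _).2 fun v hv => ?_
  ext i
  obtain ⟨x, hx⟩ := Submodule.mkQ_surjective (sInf S) (rowMul v E i - v i)
  rw [← sub_eq_zero, ← hx]
  refine (Submodule.Quotient.mk_eq_zero _).2 (Submodule.mem_sInf.2 fun N hN => ?_)
  let φ := Submodule.factor (sInf_le hN)
  have e : rowMul (fun i => φ (v i)) E = fun i => φ (v i) := by
    refine (h (ModuleCat.of Rᵐᵒᵖ (C ⧸ N))).1 (hS N hN F hF) _ ?_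
    rw [← map_rowMul, hv]
    ext; simp
  have e' := congrArg φ hx
  rw [map_sub, sub_eq_zero.2 ((congrFun (map_rowMul φ v E) i).trans (congrFun e i))] at e'
  exact (Submodule.Quotient.mk_eq_zero _).1 e'

/-- The quotient is an extension of `C ⧸ N` by a submodule of `Y`. Flatness of `C ⧸ N` puts `x = v -
vE` in `N`; then `xB = 0`, so flatness of `Y` gives `xE = x` modulo `ker φ`, while `xE = 0` as `E`
is idempotent. -/
theorem IsLeftHereditary.fpFlat_quotient_map_ker (hn : 1 < n) (hR : IsLeftHereditary R n)
    {C Y : ModuleCat.{u} Rᵐᵒᵖ} (N : Submodule Rᵐᵒᵖ C) (φ : N →ₗ[Rᵐᵒᵖ] Y)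
    (hN : FPFlat R n (ModuleCat.of Rᵐᵒᵖ (C ⧸ N))) (hY : FPFlat R n Y) :
    FPFlat R n (ModuleCat.of Rᵐᵒᵖ (C ⧸ (LinearMap.ker φ).map N.subtype)) := by
  intro F hF
  obtain ⟨κ, ν, _, _, B, E, hE, hB, h⟩ := hR.exists_matrix hn hF
  refine (h _).2 fun v hv => ?_
  let N' := (LinearMap.ker φ).map N.subtype
  let ψ : (C ⧸ N') →ₗ[Rᵐᵒᵖ] C ⧸ N := Submodule.factor (Submodule.map_subtype_le N _)
  have e : rowMul (fun i => ψ (v i)) E = fun i => ψ (v i) := by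
    refine (h (ModuleCat.of Rᵐᵒᵖ (C ⧸ N))).1 (hN F hF) _ ?_
    rw [← map_rowMul, hv]
    exact funext fun j => map_zero ψ
  have hx : ∀ i, ∃ x : N, N'.mkQ x = v i - rowMul v E i := fun i => by
    obtain ⟨y, hy⟩ := Submodule.mkQ_surjective N' (v i - rowMul v E i)
    refine ⟨⟨y, ?_⟩, hy⟩
    have e' := congrArg ψ hy
    rw [map_sub, sub_eq_zero.2 ((congrFun (map_rowMul ψ v E) i).trans (congrFun e i)).symm] at e'
    exact (Submodule.Quotient.mk_eq_zero _).1 e'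
  choose x hx using hx
  have hx' : (fun i => (N'.mkQ ∘ₗ N.subtype) (x i)) = v - rowMul v E := funext hx
  have hker : ∀ y : N, (N'.mkQ ∘ₗ N.subtype) y = 0 ↔ φ y = 0 := fun y => by
    rw [← LinearMap.mem_ker (f := φ)]
    refine (Submodule.Quotient.mk_eq_zero _).trans ?_
    simp [N']
  have e₁ : rowMul (fun i => φ (x i)) B = 0 := by
    rw [← map_rowMul]
    refine funext fun j => (hker _).1 ?_
    refine (congrFun (map_rowMul _ x B) j).trans ?_
    rw [hx', rowMul_sub, ← rowMul_mul, hB, hv, rowMul_zero_right, sub_zero]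
    rfl
  have e₂ := (h Y).1 (hY F hF) _ e₁
  rw [← map_rowMul] at e₂
  have e₃ : rowMul (v - rowMul v E) E = v - rowMul v E := by
    rw [← hx', ← map_rowMul]
    refine funext fun j => ?_
    rw [← sub_eq_zero, ← map_sub, hker, map_sub, sub_eq_zero]
    exact congrFun e₂ j
  rw [rowMul_sub, ← rowMul_mul, hE, sub_self] at e₃
  exact (sub_eq_zero.1 e₃.symm).symm

theorem IsLeftHereditary.isTorsionPair_fpFlat (hn : 1 < n) (hR : IsLeftHereditary R n) :
    IsTorsionPair (FPFlat R n).leftOrthogonal (FPFlat R n) where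
  hom_eq_zero _ _ hX hY f := hX f hY
  torsion_of_hom_eq_zero C hC Y f hY := hC Y hY f
  torsionFree_of_hom_eq_zero C hC := by
    let S : Set (Submodule Rᵐᵒᵖ C) := {N | FPFlat R n (ModuleCat.of Rᵐᵒᵖ (C ⧸ N))}
    have hS := hR.fpFlat_quotient_sInf hn C S fun N hN => hN
    have hT : (FPFlat R n).leftOrthogonal (ModuleCat.of Rᵐᵒᵖ (sInf S : Submodule Rᵐᵒᵖ C)) := by
      intro Y f hY
      -- Minimality: `ker f` also has flat quotient in `C`, so it contains `sInf S`.
      have hle := sInf_le (α := Submodule Rᵐᵒᵖ C)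
        (show _ ∈ S from hR.fpFlat_quotient_map_ker hn (sInf S) f.hom hS hY)
      ext x
      obtain ⟨y, hy, hyx⟩ := hle x.2
      rw [← Subtype.ext hyx]
      exact hy
    have h₀ := hC _ hT (ModuleCat.ofHom (sInf S).subtype)
    have hbot : sInf S = ⊥ := (Submodule.eq_bot_iff _).2 fun x hx =>
      congrArg (fun φ => φ.hom ⟨x, hx⟩) h₀
    intro F hF
    obtain ⟨κ, ν, _, _, B, E, -, -, h⟩ := hR.exists_matrix hn hF
    refine (h _).2 fun v hv => ?_
    have e := (h _).1 (hS F hF) (fun i => (sInf S).mkQ (v i)) (by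
      rw [← map_rowMul, hv]; ext; simp)
    rw [← map_rowMul] at e
    refine funext fun i => ?_
    rw [← sub_eq_zero, ← Submodule.mem_bot Rᵐᵒᵖ, ← hbot, ← Submodule.Quotient.mk_eq_zero,
      Submodule.Quotient.mk_sub, sub_eq_zero]
    exact congrFun e i

end Flat

/-! ### Closure properties of torsion pairs -/

section TorsionClass

theorem IsTorsionPair.torsionFree_of_mono {A : Type*} [Category A] [Abelian A]
    {T F : ObjectProperty A} (h : IsTorsionPair T F) {X Y : A} (i : Y ⟶ X) [Mono i] (hX : F X) :
    F Y :=
  h.torsionFree_of_hom_eq_zero Y fun Z hZ f =>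
    (cancel_mono i).1 (by rw [h.hom_eq_zero hZ hX (f ≫ i), Limits.zero_comp])

theorem IsTorsionPair.torsion_of_epi {A : Type*} [Category A] [Abelian A]
    {T F : ObjectProperty A} (h : IsTorsionPair T F) {X Y : A} (p : X ⟶ Y) [Epi p] (hX : T X) :
    T Y :=
  h.torsion_of_hom_eq_zero Y fun Z hZ f =>
    (cancel_epi p).1 (by rw [h.hom_eq_zero hX hZ (p ≫ f), Limits.comp_zero])

end TorsionClass

/-! ### From the flat torsion pair to `n`-hereditary -/

section FlatSubmodules

variable {R : Type u} [Ring R] {n : ℕ}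

theorem exists_injective_finite_free (P : Type u) [AddCommGroup P] [Module R P]
    [Module.Finite R P] [Module.Projective R P] :
    ∃ (F₀ : ModuleCat.{u} R) (i : P →ₗ[R] F₀), Module.Finite R F₀ ∧ Module.Free R F₀ ∧
      Function.Injective i := by
  obtain ⟨k, p, hp⟩ := Module.Finite.exists_fin' R P
  obtain ⟨s, hs⟩ := Module.projective_lifting_property p LinearMap.id hp
  refine ⟨ModuleCat.of R (Fin k → R), s, inferInstanceAs (Module.Finite R (Fin k → R)),
    inferInstanceAs (Module.Free R (Fin k → R)), ?_⟩
  exact Function.LeftInverse.injective (g := p) fun x => LinearMap.congr_fun hs x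

/-- Finite free right modules are flat. -/
theorem fpFlat_pi (hn : 1 < n) (ι : Type u) [Finite ι] :
    FPFlat R n (ModuleCat.of Rᵐᵒᵖ (ι → R)) := by
  intro F hF
  obtain ⟨F₂, F₁, F₀, f, g, ε, ⟨_, _⟩, ⟨_, _⟩, ⟨_, _⟩, h, h', hε, -⟩ := hF.exists_presentation hn
  let b₂ := Module.Free.chooseBasis R F₂
  let b₁ := Module.Free.chooseBasis R F₁
  let b₀ := Module.Free.chooseBasis R F₀
  refine (subsingleton_Tor_one_iff_rowMul _ b₂ b₁ b₀ h h' hε).2 fun v hv => ?_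
  -- In each coordinate `k`, `vB = 0` says that `∑ j, v j k • b₁ j` lies in `ker g = im f`.
  have hx : ∀ k : ι, ∃ y : F₂, f.hom y = ∑ j, v j k • b₁ j := fun k => by
    refine (h _).1 (b₀.repr.injective (Finsupp.ext fun l => ?_))
    have e := congrFun (congrFun hv l) k
    simp only [rowMul, Finset.sum_apply] at e
    change _ = (0 : R) at e
    simpa [Finsupp.finsetSum_apply, rowMatrix] using e
  choose y hy using hx
  refine ⟨fun i k => b₂.repr (y k) i, funext fun j => funext fun k => ?_⟩
  have e := repr_hom_apply b₂ b₁ f (y k) j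
  rw [hy, b₁.repr_sum_self] at e
  rw [e, rowMul]
  exact Finset.sum_apply _ _ _

/-- If submodules of flat right modules are flat, then the second syzygies of finitely
`n`-presented modules split. -/
theorem exists_comp_eq_of_fpFlat_of_injective (hn : 1 < n)
    (hsub : ∀ (X : ModuleCat.{u} Rᵐᵒᵖ) (L : Submodule Rᵐᵒᵖ X), FPFlat R n X →
      FPFlat R n (ModuleCat.of Rᵐᵒᵖ L))
    {F₂ F₁ F₀ F : ModuleCat.{u} R} [Module.Finite R F₂] [Module.Free R F₂]
    [Module.Finite R F₁] [Module.Free R F₁] [Module.Finite R F₀] [Module.Free R F₀]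
    {f : F₂ ⟶ F₁} {g : F₁ ⟶ F₀} {ε : F₀ ⟶ F} (h : Function.Exact f.hom g.hom)
    (h' : Function.Exact g.hom ε.hom) (hε : Function.Surjective ε.hom) (hF : FP R n F) :
    ∃ c : F₁ ⟶ F₂, f ≫ c ≫ f = f := by
  let b₂ := Module.Free.chooseBasis R F₂
  let b₁ := Module.Free.chooseBasis R F₁
  let b₀ := Module.Free.chooseBasis R F₀
  let A := rowMatrix b₂ b₁ f
  let B := rowMatrix b₁ b₀ g
  -- `a j` is the `j`-th column of `A`. The row of columns is killed by `B` as `AB = 0`; flatness of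
  -- the column space `L` writes it as `wA` with `w` in `L`, and expanding `w` in the columns gives
  -- `A = ACA`.
  let a : Module.Free.ChooseBasisIndex R F₁ → Module.Free.ChooseBasisIndex R F₂ → R :=
    fun j i => A i j
  let L : Submodule Rᵐᵒᵖ (Module.Free.ChooseBasisIndex R F₂ → R) :=
    Submodule.span Rᵐᵒᵖ (Set.range a)
  have hAB : A * B = 0 := by
    rw [← rowMatrix_comp, show f ≫ g = 0 by ext x; exact h.apply_apply_eq_zero x, rowMatrix_zero]
  have hL := hsub _ L (fpFlat_pi hn (Module.Free.ChooseBasisIndex R F₂)) F hF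
  obtain ⟨w, hw⟩ := (subsingleton_Tor_one_iff_rowMul _ b₂ b₁ b₀ h h' hε).1 hL
    (fun j => (⟨a j, Submodule.subset_span ⟨j, rfl⟩⟩ : L)) (by
      refine funext fun k => Subtype.ext ?_
      refine (congrFun (map_rowMul L.subtype _ B) k).trans (funext fun i => ?_)
      refine (Finset.sum_apply _ _ _).trans ?_
      exact congrFun (congrFun hAB i) k)
  have hc : ∀ i, ∃ c : _ → Rᵐᵒᵖ, ∑ j, c j • a j = (w i : _ → R) := fun i =>
    (Submodule.mem_span_range_iff_exists_fun _).1 (w i).2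
  choose c hc using hc
  let γ : F₁ ⟶ F₂ := ModuleCat.ofHom
    (b₁.constr ℕ fun j => ∑ i, (c i j).unop • b₂ i)
  have hγ : rowMatrix b₁ b₂ γ = Matrix.of fun j i => (c i j).unop := by
    ext j i
    have e : γ.hom (b₁ j) = ∑ i, (c i j).unop • b₂ i := b₁.constr_basis ℕ _ j
    rw [rowMatrix, e, b₂.repr_sum_self, Matrix.of_apply]
  have hA : A * (rowMatrix b₁ b₂ γ * A) = A := by
    ext l k
    have e := congrFun (congrArg Subtype.val (congrFun hw k)) l
    refine Eq.trans ?_ e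
    rw [← Matrix.mul_assoc, Matrix.mul_apply]
    refine Eq.trans ?_ (congrFun (congrFun (map_rowMul L.subtype w A) k) l).symm
    refine Eq.trans ?_ (Finset.sum_apply l Finset.univ fun i =>
      MulOpposite.op (A i k) • (L.subtype (w i) : _ → R)).symm
    refine Finset.sum_congr rfl fun i _ => ?_
    change _ = (L.subtype (w i)) l * A i k
    rw [L.subtype_apply, ← hc i, hγ, Matrix.mul_apply]
    simp [a]
  refine ⟨γ, ?_⟩
  rw [← rowMatrix_comp, ← rowMatrix_comp] at hA
  refine ModuleCat.hom_ext (b₂.ext fun i => b₁.repr.injective (Finsupp.ext fun j => ?_))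
  exact congrFun (congrFun hA i) j

theorem isLeftHereditary_of_isTorsionPair_fpFlat (hn : 1 < n)
    (hT : IsTorsionPair (FPFlat R n).leftOrthogonal (FPFlat R n)) : IsLeftHereditary R n := by
  intro P _ _ _ _ N hN
  obtain ⟨F₀, i, _, _, hi⟩ := exists_injective_finite_free (R := R) P
  have hN := hN hn.le
  have hj : Function.Injective (i ∘ₗ N.subtype) := hi.comp N.injective_subtype
  have hF : FP R n (ModuleCat.of R (F₀ ⧸ LinearMap.range (i ∘ₗ N.subtype))) := by
    have := FP.succ_of_exact (N := ModuleCat.of R N)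
      (F := ModuleCat.of R (F₀ ⧸ LinearMap.range (i ∘ₗ N.subtype))) (i ∘ₗ N.subtype)
      (Submodule.mkQ _) hj (LinearMap.exact_map_mkQ_range _) (Submodule.mkQ_surjective _) hN
    rwa [Nat.sub_add_cancel hn.le] at this
  obtain ⟨G, d, p, hG, hp, h₀, -⟩ := hN
  obtain ⟨_, _⟩ := hG 0 (by omega)
  obtain ⟨_, _⟩ := hG 1 (by omega)
  have h₀ := h₀ (by omega)
  have hsub : ∀ (X : ModuleCat.{u} Rᵐᵒᵖ) (L : Submodule Rᵐᵒᵖ X), FPFlat R n X →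
      FPFlat R n (ModuleCat.of Rᵐᵒᵖ L) := fun X L hX => by
    have : Mono (ModuleCat.ofHom L.subtype) :=
      (ModuleCat.mono_iff_injective _).2 L.injective_subtype
    exact hT.torsionFree_of_mono (ModuleCat.ofHom L.subtype) hX
  -- The presentation `G 1 → G 0` of `N` is spliced with `N → F₀ → F₀ ⧸ N`.
  obtain ⟨c, hc⟩ := exists_comp_eq_of_fpFlat_of_injective hn hsub (f := ModuleCat.ofHom (d 0))
    (g := ModuleCat.ofHom ((i ∘ₗ N.subtype) ∘ₗ p)) (ε := ModuleCat.ofHom (Submodule.mkQ _))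
    (fun y => Iff.trans (map_eq_zero_iff (i ∘ₗ N.subtype) hj) (h₀ y))
    (fun y => (LinearMap.exact_map_mkQ_range (i ∘ₗ N.subtype) y).trans
      ⟨fun ⟨x, hx⟩ => (hp x).imp fun z hz => (congrArg (i ∘ₗ N.subtype) hz).trans hx,
        fun ⟨z, hz⟩ => ⟨p z, hz⟩⟩)
    (Submodule.mkQ_surjective _) hF
  have := Module.Projective.of_free (R := R) (P := G 0)
  exact projective_of_comp_eq h₀ hp c.hom fun x => congrArg (fun φ => φ.hom x) hc

end FlatSubmodules

/-! ### The injective torsion pair -/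

section Injective

variable {R : Type u} [Ring R] {n : ℕ}

/-- Long exact sequence, with `Ext¹(P, M) = 0`. -/
theorem subsingleton_ext_one_iff (M : ModuleCat.{u} R) {K P F : ModuleCat.{u} R}
    [Module.Projective R P] (i : K →ₗ[R] P) (ε : P →ₗ[R] F) (hi : Function.Injective i)
    (h : Function.Exact i ε) (hε : Function.Surjective ε) :
    Subsingleton (Abelian.Ext F M 1) ↔ ∀ φ : K →ₗ[R] M, ∃ ψ : P →ₗ[R] M, ψ ∘ₗ i = φ := by
  have hP : Projective P := (IsProjective.iff_projective P).1 inferInstance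
  have w : ModuleCat.ofHom i ≫ ModuleCat.ofHom ε = 0 := by
    ext x; exact h.apply_apply_eq_zero x
  have hS : (ShortComplex.mk (ModuleCat.ofHom i) (ModuleCat.ofHom ε) w).ShortExact :=
    { exact := (ShortComplex.ShortExact.moduleCat_exact_iff_function_exact _).2 h
      mono_f := (ModuleCat.mono_iff_injective _).2 hi
      epi_g := (ModuleCat.epi_iff_surjective _).2 hε }
  constructor
  · intro _ φ
    obtain ⟨x, hx⟩ := Abelian.Ext.contravariant_sequence_exact₁ hS M
      (Abelian.Ext.mk₀ (ModuleCat.ofHom φ)) (add_zero 1) (Subsingleton.elim _ _)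
    obtain ⟨ψ, rfl⟩ := (Abelian.Ext.mk₀_bijective _ _).2 x
    rw [Abelian.Ext.mk₀_comp_mk₀] at hx
    exact ⟨ψ.hom, congrArg ModuleCat.Hom.hom ((Abelian.Ext.mk₀_bijective _ _).1 hx)⟩
  · intro hφ
    refine subsingleton_of_forall_eq 0 fun x => ?_
    obtain ⟨y, rfl⟩ := Abelian.Ext.contravariant_sequence_exact₃ hS M x
      (Abelian.Ext.eq_zero_of_projective _) (add_zero 1)
    obtain ⟨φ, rfl⟩ := (Abelian.Ext.mk₀_bijective _ _).2 y
    obtain ⟨ψ, hψ⟩ := hφ φ.hom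
    have e : φ = ModuleCat.ofHom i ≫ ModuleCat.ofHom ψ := ModuleCat.hom_ext hψ.symm
    rw [e, ← Abelian.Ext.mk₀_comp_mk₀]
    exact hS.extClass_comp_assoc _

/-- Over an `n`-hereditary ring, finitely `n`-presented modules have projective resolutions
of length one by finite modules. -/
theorem IsLeftHereditary.exists_resolution (hn : 1 < n) (hR : IsLeftHereditary R n)
    {F : ModuleCat.{u} R} (hF : FP R n F) :
    ∃ (K P : ModuleCat.{u} R) (i : K →ₗ[R] P), Module.Finite R K ∧ Module.Projective R K ∧
      Module.Projective R P ∧ ∀ M : ModuleCat.{u} R, Subsingleton (Abelian.Ext F M 1) ↔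
        ∀ φ : K →ₗ[R] M, ∃ ψ : P →ₗ[R] M, ψ ∘ₗ i = φ := by
  obtain ⟨F₂, F₁, F₀, f, g, ε, -, -, ⟨_, _⟩, h, h', hε, hK⟩ := hF.exists_presentation hn
  have := Module.Projective.of_free (R := R) (P := F₀)
  refine ⟨ModuleCat.of R (LinearMap.ker ε.hom), F₀, (LinearMap.ker ε.hom).subtype, ?_,
    hR F₀ _ fun _ => hK, this, fun M => subsingleton_ext_one_iff M _ ε.hom
      (Submodule.injective_subtype _) (LinearMap.exact_subtype_ker_map _) hε⟩
  obtain ⟨G, d, p, hG, hp, -⟩ := hK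
  obtain ⟨_, _⟩ := hG 0 (by omega)
  exact Module.Finite.of_surjective p hp

theorem IsLeftHereditary.fpInj_of_surjective (hn : 1 < n) (hR : IsLeftHereditary R n)
    {X Y : ModuleCat.{u} R} (p : X →ₗ[R] Y) (hp : Function.Surjective p) (hX : FPInj R n X) :
    FPInj R n Y := by
  intro F hF
  obtain ⟨K, P, i, _, _, _, h⟩ := hR.exists_resolution hn hF
  refine (h _).2 fun φ => ?_
  obtain ⟨φ', rfl⟩ := Module.projective_lifting_property p φ hp
  obtain ⟨ψ, rfl⟩ := (h _).1 (hX F hF) φ'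
  exact ⟨p ∘ₗ ψ, rfl⟩

theorem IsLeftHereditary.fpInj_sup (hn : 1 < n) (hR : IsLeftHereditary R n) {C : ModuleCat.{u} R}
    {N N' : Submodule R C} (hN : FPInj R n (ModuleCat.of R N))
    (hN' : FPInj R n (ModuleCat.of R N')) :
    FPInj R n (ModuleCat.of R (N ⊔ N' : Submodule R C)) := by
  refine hR.fpInj_of_surjective hn (X := ModuleCat.of R (N × N'))
    ((Submodule.inclusion le_sup_left).coprod (Submodule.inclusion le_sup_right)) ?_ ?_
  · rintro ⟨x, hx⟩
    obtain ⟨y, hy, z, hz, rfl⟩ := Submodule.mem_sup.1 hx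
    exact ⟨(⟨y, hy⟩, ⟨z, hz⟩), rfl⟩
  · intro F hF
    obtain ⟨K, P, i, _, _, _, h⟩ := hR.exists_resolution hn hF
    refine (h _).2 fun φ => ?_
    obtain ⟨ψ, hψ⟩ := (h _).1 (hN F hF) (LinearMap.fst R N N' ∘ₗ φ)
    obtain ⟨ψ', hψ'⟩ := (h _).1 (hN' F hF) (LinearMap.snd R N N' ∘ₗ φ)
    exact ⟨ψ.prod ψ', LinearMap.ext fun x =>
      Prod.ext (LinearMap.congr_fun hψ x) (LinearMap.congr_fun hψ' x)⟩

/-- The family is directed by `fpInj_sup`, and `K` is finite, so the image of `K` lies in a single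
member, where the extension exists. -/
theorem IsLeftHereditary.fpInj_sSup (hn : 1 < n) (hR : IsLeftHereditary R n)
    (C : ModuleCat.{u} R) :
    FPInj R n (ModuleCat.of R
      (sSup {N : Submodule R C | FPInj R n (ModuleCat.of R N)} : Submodule R C)) := by
  set S := {N : Submodule R C | FPInj R n (ModuleCat.of R N)}
  intro F hF
  obtain ⟨K, P, i, _, _, _, h⟩ := hR.exists_resolution hn hF
  refine (h _).2 fun φ => ?_
  have hbot : (⊥ : Submodule R C) ∈ S := fun F hF => by
    obtain ⟨K, P, i, _, _, _, h⟩ := hR.exists_resolution hn hF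
    exact (h _).2 fun φ =>
      ⟨0, LinearMap.ext fun x => Subsingleton.elim (α := (⊥ : Submodule R C)) _ _⟩
  have hdir : DirectedOn (· ≤ ·) S := fun N hN N' hN' =>
    ⟨N ⊔ N', hR.fpInj_sup hn hN hN', le_sup_left, le_sup_right⟩
  have hfg : (LinearMap.range ((sSup S).subtype ∘ₗ φ)).FG :=
    Module.Finite.iff_fg.1 (Module.Finite.range _)
  obtain ⟨N, hN, hle⟩ := (CompleteLattice.isCompactElement_iff_le_of_directed_sSup_le _ _).1
    ((Submodule.fg_iff_compact _).1 hfg) S ⟨⊥, hbot⟩ hdir (by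
      rintro _ ⟨x, rfl⟩
      exact (φ x).2)
  obtain ⟨ψ, hψ⟩ := (h _).1 (hN F hF)
    (((sSup S).subtype ∘ₗ φ).codRestrict N fun x => hle ⟨x, rfl⟩)
  refine ⟨Submodule.inclusion (le_sSup hN) ∘ₗ ψ, LinearMap.ext fun x => Subtype.ext ?_⟩
  exact congrArg (fun y : N => (y : C)) (LinearMap.congr_fun hψ x)

/-- Closure under extensions: extend modulo `N` through `X`, lift to `α` by projectivity of `P`,
then correct the error `φ' - α i`, which lies in `N`. -/
theorem IsLeftHereditary.fpInj_comap_range (hn : 1 < n) (hR : IsLeftHereditary R n)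
    {C X : ModuleCat.{u} R} (N : Submodule R C) (f : X →ₗ[R] C ⧸ N)
    (hN : FPInj R n (ModuleCat.of R N)) (hX : FPInj R n X) :
    FPInj R n (ModuleCat.of R ((LinearMap.range f).comap N.mkQ)) := by
  intro F hF
  obtain ⟨K, P, i, _, _, _, h⟩ := hR.exists_resolution hn hF
  refine (h _).2 fun φ => ?_
  let L := (LinearMap.range f).comap N.mkQ
  let φ' : K →ₗ[R] L := φ
  let q : L →ₗ[R] LinearMap.range f := N.mkQ.restrict fun x hx => hx
  have hq : Function.Surjective q := by
    rintro ⟨y, hy⟩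
    obtain ⟨x, rfl⟩ := N.mkQ_surjective y
    exact ⟨⟨x, hy⟩, rfl⟩
  obtain ⟨χ, hχ⟩ := Module.projective_lifting_property f.rangeRestrict (q ∘ₗ φ')
    f.surjective_rangeRestrict
  obtain ⟨χ', rfl⟩ := (h _).1 (hX F hF) χ
  obtain ⟨α, hα⟩ := Module.projective_lifting_property q (f.rangeRestrict ∘ₗ χ') hq
  have hmem : ∀ x, (L.subtype ∘ₗ (φ' - α ∘ₗ i)) x ∈ N := fun x => by
    have e₁ := LinearMap.congr_fun hχ x
    have e₂ := LinearMap.congr_fun hα (i x)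
    have e : q (φ' x - α (i x)) = 0 := by
      rw [map_sub, sub_eq_zero]
      exact e₁.symm.trans e₂.symm
    exact (Submodule.Quotient.mk_eq_zero _).1 (congrArg Subtype.val e)
  obtain ⟨β, hβ⟩ := (h _).1 (hN F hF) ((L.subtype ∘ₗ (φ' - α ∘ₗ i)).codRestrict N hmem)
  have hle : N ≤ L := fun x hx => by
    change N.mkQ x ∈ LinearMap.range f
    rw [Submodule.mkQ_apply, (Submodule.Quotient.mk_eq_zero N).2 hx]
    exact zero_mem _
  refine ⟨α + Submodule.inclusion hle ∘ₗ β, LinearMap.ext fun x => Subtype.ext ?_⟩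
  have e : ((β (i x) : N) : C) = φ' x - α (i x) :=
    congrArg Subtype.val (LinearMap.congr_fun hβ x)
  change ((α (i x) : L) : C) + ((β (i x) : N) : C) = φ' x
  rw [e, add_sub_cancel]

theorem IsLeftHereditary.isTorsionPair_fpInj (hn : 1 < n) (hR : IsLeftHereditary R n) :
    IsTorsionPair (FPInj R n) (FPInj R n).rightOrthogonal where
  hom_eq_zero _ _ hX hY f := hY f hX
  torsionFree_of_hom_eq_zero C hC X f hX := hC X hX f
  torsion_of_hom_eq_zero C hC := by
    set t := sSup {N : Submodule R C | FPInj R n (ModuleCat.of R N)} with ht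
    have hF : (FPInj R n).rightOrthogonal (ModuleCat.of R (C ⧸ t)) := by
      intro X f hX
      have hle : (LinearMap.range f.hom).comap t.mkQ ≤ t :=
        le_sSup (hR.fpInj_comap_range hn t f.hom (hR.fpInj_sSup hn C) hX)
      ext x
      obtain ⟨y, hy⟩ := t.mkQ_surjective (f.hom x)
      refine hy.symm.trans ((Submodule.Quotient.mk_eq_zero _).2 (hle ?_))
      exact ⟨x, hy.symm⟩
    have h₀ := hC _ hF (ModuleCat.ofHom t.mkQ)
    refine hR.fpInj_of_surjective hn (X := ModuleCat.of R t) t.subtype (fun x => ?_)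
      (hR.fpInj_sSup hn C)
    exact ⟨⟨x, (Submodule.Quotient.mk_eq_zero t).1 (congrArg (fun φ => φ.hom x) h₀)⟩, rfl⟩

theorem isLeftHereditary_of_isTorsionPair_fpInj (hn : 1 < n)
    (hT : IsTorsionPair (FPInj R n) (FPInj R n).rightOrthogonal) : IsLeftHereditary R n := by
  intro P _ _ _ _ N hN
  obtain ⟨F₀, i, _, _, hi⟩ := exists_injective_finite_free (R := R) P
  have := Module.Projective.of_free (R := R) (P := F₀)
  have hj : Function.Injective (i ∘ₗ N.subtype) := hi.comp N.injective_subtype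
  have hF : FP R n (ModuleCat.of R (F₀ ⧸ LinearMap.range (i ∘ₗ N.subtype))) := by
    have := FP.succ_of_exact (N := ModuleCat.of R N)
      (F := ModuleCat.of R (F₀ ⧸ LinearMap.range (i ∘ₗ N.subtype))) (i ∘ₗ N.subtype)
      (Submodule.mkQ _) hj (LinearMap.exact_map_mkQ_range _) (Submodule.mkQ_surjective _)
      (hN hn.le)
    rwa [Nat.sub_add_cancel hn.le] at this
  -- To split `p`, embed its free source in an injective `E` by `e`. Then `N ≅ (N →₀ R) ⧸ ker p`
  -- embeds in `E ⧸ e (ker p)`, which is `FP_n`-injective as a quotient of `E`.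
  refine Module.Projective.of_lifting_property'' fun p hp => ?_
  let E := Injective.under (ModuleCat.of R (N →₀ R))
  let e : (N →₀ R) →ₗ[R] E := (Injective.ι (ModuleCat.of R (N →₀ R))).hom
  have he : Function.Injective e := (ModuleCat.mono_iff_injective _).1 inferInstance
  let Z := (LinearMap.ker p).map e
  have hZ : FPInj R n (ModuleCat.of R (E ⧸ Z)) := by
    let π : E ⟶ ModuleCat.of R (E ⧸ Z) := ModuleCat.ofHom Z.mkQ
    have : Epi π := (ModuleCat.epi_iff_surjective _).2 Z.mkQ_surjective
    have : Injective E := Injective.injective_under _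
    refine hT.torsion_of_epi π fun F _ => ?_
    exact subsingleton_of_forall_eq 0 fun x => Abelian.Ext.eq_zero_of_injective x
  let j : N →ₗ[R] E ⧸ Z := Submodule.mapQ _ _ e (Submodule.map_le_iff_le_comap.1 le_rfl) ∘ₗ
    (p.quotKerEquivOfSurjective hp).symm.toLinearMap
  have hjp : ∀ a, j (p a) = Z.mkQ (e a) := fun a => by
    have e' : (p.quotKerEquivOfSurjective hp).symm (p a) = Submodule.Quotient.mk a := by
      rw [LinearEquiv.symm_apply_eq]; rfl
    simp [j, e']
  obtain ⟨ψ, hψ⟩ := (subsingleton_ext_one_iff (ModuleCat.of R (E ⧸ Z)) (K := ModuleCat.of R N)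
    (F := ModuleCat.of R (F₀ ⧸ LinearMap.range (i ∘ₗ N.subtype))) (i ∘ₗ N.subtype)
    (Submodule.mkQ _) hj (LinearMap.exact_map_mkQ_range _) (Submodule.mkQ_surjective _)).1
    (hZ _ hF) j
  obtain ⟨χ, rfl⟩ := Module.projective_lifting_property Z.mkQ ψ Z.mkQ_surjective
  -- The extension of `j` to `F₀`, lifted to `E` and restricted to `N`. It differs from `e` by
  -- elements of `e (ker p)`, so it lands in the range of `e` and its pullback is a section of `p`.
  let k : N →ₗ[R] E := χ ∘ₗ i ∘ₗ N.subtype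
  have hk : ∀ a, ∃ b, p b = 0 ∧ e b = k (p a) - e a := fun a => by
    have e' : Z.mkQ (k (p a) - e a) = 0 := by
      rw [map_sub, ← hjp, sub_eq_zero]
      exact LinearMap.congr_fun hψ (p a)
    exact (Submodule.Quotient.mk_eq_zero _).1 e'
  have hr : ∀ x, k x ∈ LinearMap.range e := fun x => by
    obtain ⟨a, rfl⟩ := hp x
    obtain ⟨b, -, hb⟩ := hk a
    exact ⟨b + a, by rw [map_add, hb, sub_add_cancel]⟩
  refine ⟨(LinearEquiv.ofInjective e he).symm.toLinearMap ∘ₗ k.codRestrict _ hr,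
    LinearMap.ext fun x => ?_⟩
  obtain ⟨a, rfl⟩ := hp x
  obtain ⟨b, hb, hab⟩ := hk a
  have e' : (LinearEquiv.ofInjective e he).symm (k.codRestrict _ hr (p a)) = b + a := by
    rw [LinearEquiv.symm_apply_eq]
    refine Subtype.ext ?_
    change k (p a) = e (b + a)
    rw [map_add, hab, sub_add_cancel]
  change p ((LinearEquiv.ofInjective e he).symm (k.codRestrict _ hr (p a))) = p a
  rw [e', map_add, hb, zero_add]

end Injective

end TorsionPairs

theorem mainTheorem2 (R : Type u) [Ring R] (n : ℕ) (hn : 1 < n) :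
    List.TFAE
      [TorsionPairs.IsLeftHereditary R n,
        TorsionPairs.IsTorsionPair (TorsionPairs.FPInj R n) (TorsionPairs.FPInj R n).rightOrthogonal,
        TorsionPairs.IsTorsionPair (TorsionPairs.FPFlat R n).leftOrthogonal
          (TorsionPairs.FPFlat R n)] := by
  tfae_have 1 → 2 := fun h => h.isTorsionPair_fpInj hn
  tfae_have 2 → 1 := TorsionPairs.isLeftHereditary_of_isTorsionPair_fpInj hn
  tfae_have 1 → 3 := fun h => h.isTorsionPair_fpFlat hn
  tfae_have 3 → 1 := TorsionPairs.isLeftHereditary_of_isTorsionPair_fpFlat hn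
  tfae_finish
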